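/- For integers $n,k\ge 1$, regard $nk\times nk$ complex matrices as elements of $\mathcal M_n(\mathbb C)\otimes\mathcal M_k(\mathbb C)$, and for such a matrix $X$ put $X^{red}:=(\mathrm{id}\otimes \mathrm{Tr})(X)\otimes I_k-X$. Let $D_{n,k}$ be the set of positive semidefinite matrices of trace $1$ in $\mathcal M_n(\mathbb C)\otimes\mathcal M_k(\mathbb C)$, and let $$\mathrm{ARED}_{n,k}:=\{\rho\in D_{n,k}\ :\ (U\rho U^*)^{red}\ge 0\ \text{ for every unitary } U \text{ on } \mathbb C^n\otimes\mathbb C^k\}.$$ For $d,s\ge 1$ let $\mu_{d,s}$ (the induced measure) be the law of $\mathrm{Tr}_{\mathbb C^s}(\psi\psi^*)$, where $\psi$ is uniformly distributed on the unit sphere of $\mathbb C^d\otimes\mathbb C^s$. **Theorem.** Let $(k_n)$ and $(s_n)$ be sequences of natural numbers such that, as $n\to\infty$, $k_n\to\infty$ and $s_n\sim c\,n k_n$ for some constant $c>0$. Let $(\rho_n)$ be random matrices defined on a common probability space such that, for all sufficiently large $n$, $\rho_n$ has law $\mu_{nk_n,s_n}$ (with an arbitrary joint distribution). 1. If $c>1$,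 then, almost surely, $\rho_n\in\mathrm{ARED}_{n,k_n}$ for all sufficiently large $n$. 2. If $c<1$, then, almost surely, $\rho_n\notin\mathrm{ARED}_{n,k_n}$ for all sufficiently large $n$. -/

import Mathlib

open MeasureTheory ProbabilityTheory Filter
open scoped Matrix Kronecker ComplexOrder

/-- Complex matrices carry the product (equivalently, Borel) σ-algebra of their entries. -/
noncomputable instance instMeasurableSpaceComplexMatrix {m n : Type*} : MeasurableSpace (Matrix m n ℂ) :=
  inferInstanceAs (MeasurableSpace (m → n → ℂ))

/-- Partial trace over the second tensor factor, `(id ⊗ Tr)(X)`. Operators on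
`ℂ^α ⊗ ℂ^β` are matrices indexed by `α × β`. -/
def partialTrace {α β : Type*} [Fintype β] (X : Matrix (α × β) (α × β) ℂ) : Matrix α α ℂ :=
  Matrix.of fun a a' => ∑ b, X (a, b) (a', b)

/-- Density matrices: positive semidefinite of unit trace. -/
def densityMatrices (ι : Type*) [Fintype ι] : Set (Matrix ι ι ℂ) :=
  {ρ | ρ.PosSemidef ∧ ρ.trace = 1}

/-- The reduction over the second tensor factor, `X^red = X_A ⊗ I - X`. -/
def reduction {α β : Type*} [Fintype β] [DecidableEq β]
    (X : Matrix (α × β) (α × β) ℂ) : Matrix (α × β) (α × β) ℂ :=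
  partialTrace X ⊗ₖ (1 : Matrix β β ℂ) - X

/-- `ARED_{n,k}`: the states on `ℂ^n ⊗ ℂ^k` satisfying the reduction criterion after conjugation by
any global unitary. -/
def ARED (n k : ℕ) : Set (Matrix (Fin n × Fin k) (Fin n × Fin k) ℂ) :=
  {ρ | ρ ∈ densityMatrices (Fin n × Fin k) ∧
    ∀ U ∈ Matrix.unitaryGroup (Fin n × Fin k) ℂ, (reduction (U * ρ * Uᴴ)).PosSemidef}

/-- The unit sphere of the Hilbert space `ℂ^ι`. -/
abbrev unitSphere (ι : Type*) [Fintype ι] : Type _ :=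
  Metric.sphere (0 : EuclideanSpace ℂ ι) 1

/-- The uniform probability distribution on the unit sphere of `ℂ^ι`: the normalized surface
measure induced by Lebesgue measure. (It is the zero measure when `ι` is empty.) -/
noncomputable def uniformSphere (ι : Type*) [Fintype ι] : Measure (unitSphere ι) :=
  ((volume : Measure (EuclideanSpace ℂ ι)).toSphere Set.univ)⁻¹ •
    (volume : Measure (EuclideanSpace ℂ ι)).toSphere

/-- The state `Tr_{ℂ^s}(ψ ψ^*)` obtained from a unit vector `ψ ∈ ℂ^ι ⊗ ℂ^s`. -/
noncomputable def inducedState {ι : Type*} [Fintype ι] {s : ℕ} (ψ : unitSphere (ι × Fin s)) :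
    Matrix ι ι ℂ :=
  partialTrace (Matrix.vecMulVec ψ.1.ofLp (star ψ.1.ofLp))

/-- The induced measure `μ_{d,s}` with `d = |ι|`: the law of `Tr_{ℂ^s}(ψ ψ^*)` for `ψ` uniform on
the unit sphere of `ℂ^ι ⊗ ℂ^s`. -/
noncomputable def inducedMeasure (ι : Type*) [Fintype ι] (s : ℕ) : Measure (Matrix ι ι ℂ) :=
  (uniformSphere (ι × Fin s)).map inducedState

/-! Put `d = n k`. Membership in `ARED` is governed here by two spectral facts. If `λ_max ≤ k
λ_min`, every rotation of the state satisfies the reduction criterion. If the kernel has dimension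
at least `2k`, some rotation violates it: one places on two rows `a₀, a₁` of the first factor
nothing but kernel vectors and one maximally entangled eigenvector.

For `c < 1` the rank is at most `s`, and `s + 2k ≤ d` eventually, so the second fact applies surely
(`exists_not_posSemidef_reduction_of_rank_le`).

For `c > 1` the condition number of the state is bounded by a constant outside an event of
exponentially small probability, while `k → ∞`. The eigenvalues are the values of `‖ψ^* x‖²` at unit
eigenvectors `x`. At a fixed `x`, comparing an anisotropic Gaussian integral with the isotropic one
gives tails of the form (constant)^s (`toSphere_le_of_sum_repr_le`). A net of the sphere of `ℂ^d`
makes them uniform in `x` (`exists_uniformSphere_condition_number_tail`); the lower edge needs `s -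
d` proportional to `s`. Borel–Cantelli, which needs no independence, concludes. -/

/-! ### Gaussian integrals and a Chernoff bound on the sphere -/

/-- The Gaussian integral on `ℂ^ι` with independent coordinates of inverse variances `a i`. -/
theorem lintegral_exp_neg_sum_mul_sq_norm {ι : Type*} [Fintype ι] {a : ι → ℝ} (ha : ∀ i, 0 < a i) :
    ∫⁻ z : ι → ℂ, ENNReal.ofReal (Real.exp (-∑ i, a i * ‖z i‖ ^ 2)) =
      ENNReal.ofReal (∏ i, (Real.pi / a i)) := by
  have h1 : ∀ i, ∫ z : ℂ, Real.exp (-a i * ‖z‖ ^ 2) = Real.pi / a i := by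
    intro i
    rw [GaussianFourier.integral_rexp_neg_mul_sq_norm (ha i)]
    simp [Complex.finrank_real_complex]
  have hint : ∀ i, Integrable (fun z : ℂ => Real.exp (-a i * ‖z‖ ^ 2)) := by
    intro i
    -- A non-integrable function has Bochner integral `0`, so the nonzero value `π / a i` forces
    -- integrability.
    refine not_imp_comm.1 integral_undef ?_
    rw [h1]
    have := ha i
    positivity
  have heq : (fun z : ι → ℂ => Real.exp (-∑ i, a i * ‖z i‖ ^ 2)) =
      fun z => ∏ i, Real.exp (-a i * ‖z i‖ ^ 2) := by
    funext z
    rw [← Real.exp_sum]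
    simp
  have hI : Integrable (fun z : ι → ℂ => ∏ i, Real.exp (-a i * ‖z i‖ ^ 2)) :=
    Integrable.fintype_prod (f := fun i (z : ℂ) => Real.exp (-a i * ‖z‖ ^ 2)) hint
  have h2 := integral_fintype_prod_volume_eq_prod (fun i (z : ℂ) => Real.exp (-a i * ‖z‖ ^ 2))
  simp only [h1] at h2
  rw [← h2, ofReal_integral_eq_lintegral_ofReal hI
    (Eventually.of_forall fun z => Finset.prod_nonneg fun i _ => (Real.exp_pos _).le)]
  exact lintegral_congr fun z => by rw [congrFun heq z]

/-- In any orthonormal coordinates, anisotropic Gaussian integrals on `EuclideanSpace ℂ ι` are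
given by the usual formula, up to the normalization of the Haar measure. -/
theorem exists_lintegral_exp_neg_sum_repr {ι : Type*} [Fintype ι]
    (b : OrthonormalBasis ι ℂ (EuclideanSpace ℂ ι)) :
    ∃ C : ENNReal, C ≠ 0 ∧ C ≠ ⊤ ∧ ∀ a : ι → ℝ, (∀ i, 0 < a i) →
      ∫⁻ y : EuclideanSpace ℂ ι, ENNReal.ofReal (Real.exp (-∑ i, a i * ‖b.repr y i‖ ^ 2)) =
        C * ENNReal.ofReal (∏ i, (Real.pi / a i)) := by
  let L₀ : EuclideanSpace ℂ ι ≃L[ℂ] (ι → ℂ) :=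
    b.repr.toContinuousLinearEquiv.trans (EuclideanSpace.equiv ι ℂ)
  let L : EuclideanSpace ℂ ι ≃L[ℝ] (ι → ℂ) := (L₀.toLinearEquiv.restrictScalars ℝ).toContinuousLinearEquiv
  have hL : ∀ y i, L y i = b.repr y i := fun y i => rfl
  -- By uniqueness of Haar measure, `C` does not depend on the weights `a`. It cancels when two
  -- choices of weights are compared, so its value is never needed.
  have hmap := ContinuousLinearEquiv.isAddHaarMeasure_map L (volume : Measure (EuclideanSpace ℂ ι))
  obtain ⟨c, hpos, hsm⟩ : ∃ c : NNReal, 0 < c ∧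
      Measure.map L (volume : Measure (EuclideanSpace ℂ ι)) = c • volume :=
    ⟨_, Measure.addHaarScalarFactor_pos_of_isAddHaarMeasure _ _,
      Measure.isAddLeftInvariant_eq_smul _ _⟩
  refine ⟨_, ENNReal.coe_ne_zero.2 hpos.ne', ENNReal.coe_ne_top, fun a ha => ?_⟩
  rw [← lintegral_exp_neg_sum_mul_sq_norm ha, ← lintegral_const_mul' _ _ ENNReal.coe_ne_top]
  simp only [← hL]
  have hme : MeasurableEmbedding (L : EuclideanSpace ℂ ι → (ι → ℂ)) :=
    L.toHomeomorph.measurableEmbedding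
  rw [← hme.lintegral_map
    (fun z : ι → ℂ => ENNReal.ofReal (Real.exp (-∑ i, a i * ‖z i‖ ^ 2))), hsm,
    lintegral_const_mul' _ _ ENNReal.coe_ne_top, lintegral_smul_measure]
  rfl

/-- Integration in polar coordinates against the surface measure. -/
theorem lintegral_eq_lintegral_toSphere {E : Type*} [NormedAddCommGroup E] [NormedSpace ℝ E]
    [MeasurableSpace E] [BorelSpace E] [FiniteDimensional ℝ E] [Nontrivial E] (μ : Measure E)
    [μ.IsAddHaarMeasure] (f : E → ENNReal) :
    ∫⁻ y, f y ∂μ = ∫⁻ p : Metric.sphere (0 : E) 1 × Set.Ioi (0 : ℝ), f (p.2.1 • p.1.1)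
      ∂(μ.toSphere.prod (Measure.volumeIoiPow (Module.finrank ℝ E - 1))) := by
  have hmp := (μ.measurePreserving_homeomorphUnitSphereProd).symm
    (homeomorphUnitSphereProd E).toMeasurableEquiv
  have h := hmp.lintegral_comp_emb (MeasurableEquiv.measurableEmbedding _)
    (fun y : ({0}ᶜ : Set E) => f y)
  have h0 : ∫⁻ y, f y ∂μ = ∫⁻ y in ({0}ᶜ : Set E), f y ∂μ := by
    rw [restrict_compl_singleton]
  rw [h0, ← lintegral_subtype_comap (measurableSet_singleton (0 : E)).compl, ← h]
  exact lintegral_congr fun p => congrArg f (homeomorphUnitSphereProd_symm_apply_coe E p).symm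

/-- Chernoff bound on the sphere: a set on which a quadratic form that is diagonal in an
orthonormal basis is at most `1` has proportion at most the inverse determinant of the form. -/
theorem toSphere_le_of_sum_repr_le {ι : Type*} [Fintype ι] [Nonempty ι]
    (b : OrthonormalBasis ι ℂ (EuclideanSpace ℂ ι)) {a : ι → ℝ} (ha : ∀ i, 0 < a i)
    {A : Set (unitSphere ι)} (hAm : MeasurableSet A)
    (hA : ∀ ψ ∈ A, ∑ i, a i * ‖b.repr ψ.1 i‖ ^ 2 ≤ 1) :
    (volume : Measure (EuclideanSpace ℂ ι)).toSphere A ≤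
      ENNReal.ofReal (∏ i, (a i)⁻¹) *
        (volume : Measure (EuclideanSpace ℂ ι)).toSphere Set.univ := by
  obtain ⟨C, hC0, hCt, hC⟩ := exists_lintegral_exp_neg_sum_repr b
  set σ := (volume : Measure (EuclideanSpace ℂ ι)).toSphere with hσ
  set ν := Measure.volumeIoiPow (Module.finrank ℝ (EuclideanSpace ℂ ι) - 1)
  set R : ENNReal := ∫⁻ r : Set.Ioi (0 : ℝ), ENNReal.ofReal (Real.exp (-r.1 ^ 2)) ∂ν with hR
  have hmr : Measurable fun r : Set.Ioi (0 : ℝ) => ENNReal.ofReal (Real.exp (-r.1 ^ 2)) := by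
    fun_prop
  have huniv : σ Set.univ * R = C * ENNReal.ofReal (Real.pi ^ Fintype.card ι) := by
    have h1 := hC (fun _ => 1) (fun _ => one_pos)
    simp only [one_mul, div_one, Finset.prod_const, Finset.card_univ] at h1
    rw [← h1, lintegral_eq_lintegral_toSphere]
    have : ∀ p : unitSphere ι × Set.Ioi (0 : ℝ),
        ENNReal.ofReal (Real.exp (-∑ i, ‖b.repr (p.2.1 • p.1.1) i‖ ^ 2)) =
          1 * ENNReal.ofReal (Real.exp (-p.2.1 ^ 2)) := by
      intro p
      rw [← EuclideanSpace.norm_sq_eq, LinearIsometryEquiv.norm_map, norm_smul,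
        mem_sphere_zero_iff_norm.1 p.1.2, mul_one, Real.norm_eq_abs, sq_abs, one_mul]
    simp only [this]
    rw [lintegral_prod_mul (f := fun _ => 1) aemeasurable_const hmr.aemeasurable, lintegral_const,
      one_mul]
  -- On the cone over `A` the form at `r • ψ` is at most `r²`, so the weighted Gaussian dominates
  -- `exp (-r²)` there.
  have hAle : σ A * R ≤ C * ENNReal.ofReal (∏ i, (Real.pi / a i)) := by
    rw [← hC a ha, lintegral_eq_lintegral_toSphere]
    calc σ A * R = ∫⁻ p : unitSphere ι × Set.Ioi (0 : ℝ),
          A.indicator 1 p.1 * ENNReal.ofReal (Real.exp (-p.2.1 ^ 2)) ∂(σ.prod ν) := by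
          rw [lintegral_prod_mul (measurable_one.indicator hAm).aemeasurable hmr.aemeasurable,
            lintegral_indicator_one hAm]
      _ ≤ _ := by
          refine lintegral_mono fun p => ?_
          by_cases hp : p.1 ∈ A
          · simp only [Set.indicator_of_mem hp, Pi.one_apply, one_mul]
            refine ENNReal.ofReal_le_ofReal (Real.exp_le_exp.2 (neg_le_neg ?_))
            have h2 : ∀ i, ‖b.repr (p.2.1 • p.1.1) i‖ ^ 2 = p.2.1 ^ 2 * ‖b.repr p.1.1 i‖ ^ 2 := by
              intro i
              have : b.repr (p.2.1 • p.1.1) = p.2.1 • b.repr p.1.1 := by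
                rw [← algebraMap_smul ℂ p.2.1 p.1.1, map_smul, algebraMap_smul]
              rw [this, PiLp.smul_apply, norm_smul, mul_pow, Real.norm_eq_abs, sq_abs]
            have h3 : ∑ i, a i * ‖b.repr (p.2.1 • p.1.1) i‖ ^ 2 =
                p.2.1 ^ 2 * ∑ i, a i * ‖b.repr p.1.1 i‖ ^ 2 := by
              rw [Finset.mul_sum]
              exact Finset.sum_congr rfl fun i _ => by rw [h2]; ring
            rw [h3]
            exact mul_le_of_le_one_right (sq_nonneg _) (hA _ hp)
          · simp [Set.indicator_of_notMem hp]
  have hpi : (0 : ℝ) < Real.pi ^ Fintype.card ι := by positivity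
  have hne0 : σ Set.univ * R ≠ 0 := by
    rw [huniv]
    exact mul_ne_zero hC0 (by simpa using hpi)
  have hnet : σ Set.univ * R ≠ ⊤ := by
    rw [huniv]
    exact ENNReal.mul_ne_top hCt ENNReal.ofReal_ne_top
  have hR0 : R ≠ 0 := right_ne_zero_of_mul hne0
  have hRt : R ≠ ⊤ := fun h => hnet (by rw [h, ENNReal.mul_top (left_ne_zero_of_mul hne0)])
  rw [← ENNReal.mul_le_mul_iff_left hR0 hRt, mul_assoc, huniv]
  refine hAle.trans (le_of_eq ?_)
  have h4 : ∏ i, (Real.pi / a i) = (∏ i, (a i)⁻¹) * Real.pi ^ Fintype.card ι := by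
    simp only [div_eq_mul_inv, Finset.prod_mul_distrib, Finset.prod_const, Finset.card_univ]
    ring
  rw [h4, ENNReal.ofReal_mul (Finset.prod_nonneg fun i _ => (inv_pos.2 (ha i)).le)]
  ring

theorem uniformSphere_le_of_sum_repr_le {ι : Type*} [Fintype ι] [Nonempty ι]
    (b : OrthonormalBasis ι ℂ (EuclideanSpace ℂ ι)) {a : ι → ℝ} (ha : ∀ i, 0 < a i)
    {A : Set (unitSphere ι)} (hAm : MeasurableSet A)
    (hA : ∀ ψ ∈ A, ∑ i, a i * ‖b.repr ψ.1 i‖ ^ 2 ≤ 1) :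
    uniformSphere ι A ≤ ENNReal.ofReal (∏ i, (a i)⁻¹) := by
  rw [uniformSphere, Measure.smul_apply, smul_eq_mul]
  refine (mul_le_mul_right (toSphere_le_of_sum_repr_le b ha hAm hA) _).trans (le_of_eq ?_)
  rw [mul_comm, mul_assoc, ENNReal.mul_inv_cancel, mul_one]
  · exact (Measure.measure_univ_ne_zero).2 (Measure.toSphere_ne_zero _)
  · exact measure_ne_top _ _

/-! ### Nets of the unit sphere -/

/-- An `ε`-separated subset of the unit ball has at most `(1 + 2 / ε) ^ dim` elements. -/
theorem card_le_of_separated_unitBall {E : Type*} [NormedAddCommGroup E] [NormedSpace ℝ E]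
    [FiniteDimensional ℝ E] {ε : ℝ} (hε : 0 < ε) (s : Finset E) (hs : ∀ c ∈ s, ‖c‖ ≤ 1)
    (h : ∀ c ∈ s, ∀ d ∈ s, c ≠ d → ε ≤ ‖c - d‖) :
    (s.card : ℝ) ≤ (1 + 2 / ε) ^ Module.finrank ℝ E := by
  borelize E
  let μ : Measure E := Measure.addHaar
  have hδ : 0 < ε / 2 := by positivity
  have hρ : 0 < 1 + ε / 2 := by positivity
  have D : Set.PairwiseDisjoint (s : Set E) fun c => Metric.ball c (ε / 2) := by
    rintro c hc d hd hcd
    apply Metric.ball_disjoint_ball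
    rw [dist_eq_norm]
    linarith [h c hc d hd hcd]
  have hsub : (⋃ c ∈ s, Metric.ball c (ε / 2)) ⊆ Metric.ball (0 : E) (1 + ε / 2) := by
    refine Set.iUnion₂_subset fun x hx => Metric.ball_subset_ball' ?_
    rw [dist_zero_right]
    linarith [hs x hx]
  have I := measure_mono (μ := μ) hsub
  rw [measure_biUnion_finset D fun c _ => measurableSet_ball] at I
  simp only [μ.addHaar_ball_of_pos _ hδ, μ.addHaar_ball_of_pos _ hρ, Finset.sum_const,
    nsmul_eq_mul, ← mul_assoc] at I
  have J := (ENNReal.mul_le_mul_iff_left (Metric.measure_ball_pos μ (0 : E) zero_lt_one).ne'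
    measure_ball_lt_top.ne).1 I
  have K := ENNReal.toReal_le_of_le_ofReal (by positivity) J
  rw [ENNReal.toReal_mul, ENNReal.toReal_natCast, ENNReal.toReal_ofReal (by positivity)] at K
  have hpow : (0 : ℝ) < (ε / 2) ^ Module.finrank ℝ E := by positivity
  refine le_of_mul_le_mul_right (K.trans (le_of_eq ?_)) hpow
  rw [← mul_pow]
  congr 1
  field_simp
  ring

/-- The unit sphere has an `ε`-net with at most `(1 + 2 / ε) ^ dim` elements. -/
theorem exists_net_unitSphere (E : Type*) [NormedAddCommGroup E] [NormedSpace ℝ E]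
    [FiniteDimensional ℝ E] {ε : ℝ} (hε : 0 < ε) :
    ∃ N : Finset E, (∀ x ∈ N, ‖x‖ = 1) ∧ (∀ y : E, ‖y‖ = 1 → ∃ x ∈ N, ‖y - x‖ ≤ ε) ∧
      (N.card : ℝ) ≤ (1 + 2 / ε) ^ Module.finrank ℝ E := by
  classical
  -- A separated set of maximal cardinality is a net: a point far from all its elements could be
  -- added.
  let S : Set ℕ := {m | ∃ s : Finset E, (∀ c ∈ s, ‖c‖ = 1) ∧
    (∀ c ∈ s, ∀ d ∈ s, c ≠ d → ε ≤ ‖c - d‖) ∧ s.card = m}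
  have hne : S.Nonempty := ⟨0, ∅, by simp, by simp, by simp⟩
  have hbdd : BddAbove S := by
    refine ⟨⌊(1 + 2 / ε) ^ Module.finrank ℝ E⌋₊, ?_⟩
    rintro m ⟨s, hs1, hs2, rfl⟩
    exact Nat.le_floor (card_le_of_separated_unitBall hε s (fun c hc => (hs1 c hc).le) hs2)
  obtain ⟨N, hN1, hN2, hN3⟩ := Nat.sSup_mem hne hbdd
  refine ⟨N, hN1, fun y hy => ?_,
    card_le_of_separated_unitBall hε N (fun c hc => (hN1 c hc).le) hN2⟩
  by_contra! hfar
  have hyN : y ∉ N := fun h => by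
    have := hfar y h
    simp at this
    linarith
  have hmem : N.card + 1 ∈ S := by
    refine ⟨insert y N, ?_, ?_, Finset.card_insert_of_notMem hyN⟩
    · intro c hc
      rcases Finset.mem_insert.1 hc with rfl | hc
      · exact hy
      · exact hN1 c hc
    · intro c hc d hd hcd
      rcases Finset.mem_insert.1 hc with hcy | hc' <;> rcases Finset.mem_insert.1 hd with hdy | hd'
      · exact absurd (hcy.trans hdy.symm) hcd
      · exact hcy ▸ (hfar d hd').le
      · rw [norm_sub_rev]
        exact hdy ▸ (hfar c hc').le
      · exact hN2 c hc' d hd' hcd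
  have := le_csSup hbdd hmem
  omega

/-- A bound on a `1/2`-net of the unit sphere controls the operator norm. -/
theorem opNorm_le_of_net {E F : Type*} [NormedAddCommGroup E] [NormedSpace ℂ E]
    [NormedAddCommGroup F] [NormedSpace ℂ F] (T : E →L[ℂ] F) {N : Finset E} {R : ℝ} (hR : 0 ≤ R)
    (hN : ∀ y : E, ‖y‖ = 1 → ∃ x ∈ N, ‖y - x‖ ≤ 1 / 2) (hT : ∀ x ∈ N, ‖T x‖ ≤ R) :
    ‖T‖ ≤ 2 * R := by
  have h : ‖T‖ ≤ R + ‖T‖ * (1 / 2) := by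
    refine T.opNorm_le_of_unit_norm (by positivity) fun y hy => ?_
    obtain ⟨x, hx, hxy⟩ := hN y hy
    calc ‖T y‖ = ‖T x + T (y - x)‖ := by rw [← map_add]; simp
      _ ≤ ‖T x‖ + ‖T (y - x)‖ := norm_add_le _ _
      _ ≤ R + ‖T‖ * (1 / 2) :=
        add_le_add (hT x hx) ((T.le_opNorm _).trans (mul_le_mul_of_nonneg_left hxy (norm_nonneg _)))
  linarith

/-- A lower bound on a net of the unit sphere extends to the whole sphere. -/
theorem le_norm_apply_of_net {E F : Type*} [NormedAddCommGroup E] [NormedSpace ℂ E]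
    [NormedAddCommGroup F] [NormedSpace ℂ F] (T : E →L[ℂ] F) {N : Finset E} {ε r R : ℝ}
    (hN : ∀ y : E, ‖y‖ = 1 → ∃ x ∈ N, ‖y - x‖ ≤ ε) (hT : ∀ x ∈ N, r ≤ ‖T x‖)
    (hTR : ‖T‖ ≤ R) (y : E) (hy : ‖y‖ = 1) : r - R * ε ≤ ‖T y‖ := by
  obtain ⟨x, hx, hxy⟩ := hN y hy
  have h1 : ‖T x‖ ≤ ‖T y‖ + ‖T (y - x)‖ := by
    calc ‖T x‖ = ‖T y - T (y - x)‖ := by rw [← map_sub]; simp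
      _ ≤ _ := norm_sub_le _ _
  have h2 : ‖T (y - x)‖ ≤ R * ε :=
    (T.le_opNorm _).trans (mul_le_mul hTR hxy (norm_nonneg _) ((norm_nonneg _).trans hTR))
  linarith [hT x hx]

/-! ### Contraction with a fixed unit vector -/

/-- A vector of `ℂ^ι ⊗ ℂ^κ` as a matrix. -/
def vecMatrix {ι κ : Type*} (v : ι × κ → ℂ) : Matrix ι κ ℂ :=
  Matrix.of fun i j => v (i, j)

/-- The operator `ℂ^ι → ℂ^κ` that is adjoint to the matrix of a vector of `ℂ^ι ⊗ ℂ^κ`. -/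
noncomputable def adjointMap {ι κ : Type*} [Fintype ι] [DecidableEq ι] [Fintype κ]
    (ψ : EuclideanSpace ℂ (ι × κ)) : EuclideanSpace ℂ ι →L[ℂ] EuclideanSpace ℂ κ :=
  LinearMap.toContinuousLinearMap (Matrix.toLpLin 2 2 (vecMatrix ψ.ofLp)ᴴ)

theorem ofLp_adjointMap {ι κ : Type*} [Fintype ι] [DecidableEq ι] [Fintype κ]
    (ψ : EuclideanSpace ℂ (ι × κ)) (x : EuclideanSpace ℂ ι) :
    (adjointMap ψ x).ofLp = (vecMatrix ψ.ofLp)ᴴ *ᵥ x.ofLp := rfl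

theorem adjointMap_apply {ι κ : Type*} [Fintype ι] [DecidableEq ι] [Fintype κ]
    (ψ : EuclideanSpace ℂ (ι × κ)) (x : EuclideanSpace ℂ ι) (j : κ) :
    adjointMap ψ x j = ∑ i, star (ψ (i, j)) * x i := by
  rw [ofLp_adjointMap]
  rfl

theorem continuous_adjointMap_apply {ι κ : Type*} [Fintype ι] [DecidableEq ι] [Fintype κ]
    (x : EuclideanSpace ℂ ι) :
    Continuous fun ψ : EuclideanSpace ℂ (ι × κ) => adjointMap ψ x := by
  refine (PiLp.continuous_toLp 2 (fun _ : κ => ℂ)).comp (continuous_pi fun j => ?_)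
  change Continuous fun ψ : EuclideanSpace ℂ (ι × κ) => ∑ i, star (ψ (i, j)) * x i
  fun_prop

/-- Orthonormal coordinates on `ℂ^ι ⊗ ℂ^κ` one row of which is the contraction with a given unit
vector of `ℂ^ι`. -/
theorem exists_orthonormalBasis_contraction {ι κ : Type*} [Fintype ι] [DecidableEq ι] [Fintype κ]
    [DecidableEq κ] (i₀ : ι) {x : EuclideanSpace ℂ ι} (hx : ‖x‖ = 1) :
    ∃ b : OrthonormalBasis (ι × κ) ℂ (EuclideanSpace ℂ (ι × κ)),
      ∀ ψ j, ‖b.repr ψ (i₀, j)‖ = ‖adjointMap ψ x j‖ := by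
  -- `v (i, j) = x ⊗ e_j` whatever `i` is; only the row `i₀` is kept, and the basis is completed
  -- arbitrarily.
  let v : ι × κ → EuclideanSpace ℂ (ι × κ) := fun p =>
    WithLp.toLp 2 fun q => x q.1 * if q.2 = p.2 then 1 else 0
  have hin : ∀ p (ψ : EuclideanSpace ℂ (ι × κ)),
      inner ℂ (v p) ψ = ∑ i, ψ (i, p.2) * star (x i) := by
    intro p ψ
    rw [PiLp.inner_apply, Fintype.sum_prod_type]
    refine Finset.sum_congr rfl fun i _ => ?_
    simp [v, apply_ite (starRingEnd ℂ)]
  have horth : Orthonormal ℂ (({p | p.1 = i₀} : Set (ι × κ)).domRestrict v) := by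
    rw [orthonormal_iff_ite]
    rintro ⟨⟨i, j⟩, hi⟩ ⟨⟨i', j'⟩, hi'⟩
    obtain rfl : i = i₀ := hi
    obtain rfl : i' = i := hi'
    have h1 : ∑ k, x k * star (x k) = 1 := by
      have := EuclideanSpace.inner_eq_star_dotProduct x x
      rw [inner_self_eq_norm_sq_to_K, hx] at this
      simpa [dotProduct] using this.symm
    simp only [Set.domRestrict_apply, hin]
    by_cases h : j = j'
    · subst h
      simpa [v] using h1
    · simp [v, h, Prod.ext_iff]
  obtain ⟨b, hb⟩ := horth.exists_orthonormalBasis_extension_of_card_eq (by simp)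
  refine ⟨b, fun ψ j => ?_⟩
  rw [b.repr_apply_apply, hb (i₀, j) rfl, hin, adjointMap_apply, ← norm_star, star_sum]
  simp [mul_comm]

/-- Chernoff bound for the quadratic form `‖ψ^* x‖²` at a fixed unit vector. -/
theorem uniformSphere_adjointMap_le {ι κ : Type*} [Fintype ι] [DecidableEq ι] [Fintype κ]
    [Nonempty κ] {x : EuclideanSpace ℂ ι} (hx : ‖x‖ = 1) {α β : ℝ} (hα : 0 < α) (hβ : 0 < β)
    {A : Set (unitSphere (ι × κ))} (hAm : MeasurableSet A)
    (hA : ∀ ψ ∈ A, β + (α - β) * ‖adjointMap ψ.1 x‖ ^ 2 ≤ 1) :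
    uniformSphere (ι × κ) A ≤
      ENNReal.ofReal ((α * β ^ (Fintype.card ι - 1))⁻¹ ^ Fintype.card κ) := by
  classical
  obtain ⟨i₀⟩ : Nonempty ι := by
    by_contra h
    rw [not_nonempty_iff] at h
    simp [Subsingleton.elim x 0] at hx
  have : Nonempty ι := ⟨i₀⟩
  obtain ⟨b, hb⟩ := exists_orthonormalBasis_contraction (κ := κ) i₀ hx
  -- Weight `α` on row `i₀` and `β` elsewhere: since `‖ψ‖ = 1`, the form equals `β + (α - β) ‖ψ^*
  -- x‖²`.
  refine (uniformSphere_le_of_sum_repr_le b (a := fun p => if p.1 = i₀ then α else β) ?_ hAm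
    fun ψ hψ => ?_).trans (le_of_eq ?_)
  · intro p
    split_ifs <;> assumption
  · refine le_trans (le_of_eq ?_) (hA ψ hψ)
    have h1 : ∑ p, ‖b.repr ψ.1 p‖ ^ 2 = 1 := by
      rw [← EuclideanSpace.norm_sq_eq, LinearIsometryEquiv.norm_map,
        mem_sphere_zero_iff_norm.1 ψ.2, one_pow]
    have h2 : ∀ p : ι × κ, (if p.1 = i₀ then α else β) * ‖b.repr ψ.1 p‖ ^ 2 =
        β * ‖b.repr ψ.1 p‖ ^ 2 + if p.1 = i₀ then (α - β) * ‖b.repr ψ.1 p‖ ^ 2 else 0 := by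
      intro p
      split_ifs <;> ring
    simp only [h2]
    rw [Finset.sum_add_distrib, ← Finset.mul_sum, h1, mul_one, Fintype.sum_prod_type,
      Finset.sum_eq_single i₀ (fun i _ hi => by simp [hi]) (by simp), EuclideanSpace.norm_sq_eq,
      Finset.mul_sum]
    simp [hb]
  · congr 1
    rw [Fintype.prod_prod_type, Finset.prod_comm]
    change ∏ _j : κ, ∏ i : ι, (if i = i₀ then α else β)⁻¹ = _
    rw [Finset.prod_const, Finset.card_univ]
    congr 1
    rw [← Finset.mul_prod_erase _ _ (Finset.mem_univ i₀), if_pos rfl, mul_inv,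
      Finset.prod_congr rfl (g := fun _ => β⁻¹)
        (fun i hi => by rw [if_neg (Finset.ne_of_mem_erase hi)])]
    simp [Finset.card_erase_of_mem]

/-- Upper tail of `‖ψ^* x‖²`. -/
theorem uniformSphere_upper_tail {ι κ : Type*} [Fintype ι] [DecidableEq ι] [Fintype κ]
    [Nonempty κ] (hι : 2 ≤ Fintype.card ι) {x : EuclideanSpace ℂ ι} (hx : ‖x‖ = 1) {K : ℝ}
    (hK : 0 < K) :
    uniformSphere (ι × κ) {ψ | K / Fintype.card ι ≤ ‖adjointMap ψ.1 x‖ ^ 2} ≤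
      ENNReal.ofReal ((8 / K) ^ Fintype.card κ) := by
  have hd : (2 : ℝ) ≤ Fintype.card ι := by exact_mod_cast hι
  set d := Fintype.card ι with hdd
  have hd0 : (0 : ℝ) < d := by linarith
  -- Here `α - β = -1/2`, so the form is at most `1` exactly when `‖ψ^* x‖² ≥ K / d`. Bernoulli then
  -- bounds `β ^ (d - 1)` below by `1 + K / 4`.
  refine (uniformSphere_adjointMap_le hx (α := 1 / 2 + K / (2 * d)) (β := 1 + K / (2 * d))
    (by positivity) (by positivity) ?_ ?_).trans (ENNReal.ofReal_le_ofReal ?_)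
  · exact (isClosed_le continuous_const
      (((continuous_adjointMap_apply x).comp continuous_subtype_val).norm.pow 2)).measurableSet
  · intro ψ hψ
    have h : K / d ≤ ‖adjointMap ψ.1 x‖ ^ 2 := hψ
    have h2 : K / (2 * d) = K / d / 2 := by field_simp
    rw [h2]
    linarith
  · refine pow_le_pow_left₀ (by positivity) ?_ _
    have h1 : 1 + K / 4 ≤ (1 + K / (2 * d)) ^ (d - 1) := by
      have hb := one_add_mul_le_pow (a := K / (2 * d))
        (by linarith [show 0 ≤ K / (2 * (d : ℝ)) by positivity]) (d - 1)
      refine le_trans ?_ hb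
      rw [Nat.cast_sub (by omega), Nat.cast_one, add_le_add_iff_left, ← mul_div_assoc,
        div_le_div_iff₀ (by norm_num) (by positivity)]
      nlinarith
    have h2 : K / 8 ≤ (1 / 2 + K / (2 * d)) * (1 + K / (2 * d)) ^ (d - 1) := by
      calc K / 8 ≤ 1 / 2 * (1 + K / 4) := by linarith
        _ ≤ _ := mul_le_mul (by linarith [show 0 ≤ K / (2 * (d : ℝ)) by positivity]) h1
          (by positivity) (by positivity)
    calc _ ≤ (K / 8)⁻¹ := inv_anti₀ (by positivity) h2
      _ = 8 / K := inv_div _ _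

/-- Lower tail of `‖ψ^* x‖²`. -/
theorem uniformSphere_lower_tail {ι κ : Type*} [Fintype ι] [DecidableEq ι] [Fintype κ]
    [Nonempty κ] (hι : 2 ≤ Fintype.card ι) {x : EuclideanSpace ℂ ι} (hx : ‖x‖ = 1) {t : ℝ}
    (ht : 0 < t) :
    uniformSphere (ι × κ) {ψ | ‖adjointMap ψ.1 x‖ ^ 2 ≤ t / Fintype.card ι} ≤
      ENNReal.ofReal ((4 * t) ^ Fintype.card κ) := by
  have hd : (2 : ℝ) ≤ Fintype.card ι := by exact_mod_cast hι
  set d := Fintype.card ι with hdd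
  have hd0 : (0 : ℝ) < d := by linarith
  have hβ : 0 < 1 - 1 / (2 * (d : ℝ)) := by
    rw [sub_pos, div_lt_one (by positivity)]
    linarith
  -- Here `α - β = 1 / (2t)`, so the form is at most `1` exactly when `‖ψ^* x‖² ≤ t / d`. Bernoulli
  -- gives `β ^ (d - 1) ≥ 1/2`.
  refine (uniformSphere_adjointMap_le hx (α := 1 - 1 / (2 * d) + 1 / (2 * t))
    (β := 1 - 1 / (2 * d)) (by positivity) hβ ?_ ?_).trans (ENNReal.ofReal_le_ofReal ?_)
  · exact (isClosed_le (((continuous_adjointMap_apply x).comp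
      continuous_subtype_val).norm.pow 2) continuous_const).measurableSet
  · intro ψ hψ
    have h : ‖adjointMap ψ.1 x‖ ^ 2 ≤ t / d := hψ
    have h2 : 1 / (2 * t) * (t / d) = 1 / (2 * d) := by field_simp
    have h3 := mul_le_mul_of_nonneg_left h (show 0 ≤ 1 / (2 * t) by positivity)
    rw [h2] at h3
    linarith
  · refine pow_le_pow_left₀ (by positivity) ?_ _
    have h1 : 1 / 2 ≤ (1 - 1 / (2 * (d : ℝ))) ^ (d - 1) := by
      have hb := one_add_mul_le_pow (a := -(1 / (2 * (d : ℝ)))) (by linarith) (d - 1)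
      rw [← sub_eq_add_neg] at hb
      refine le_trans ?_ hb
      have h5 : ((d - 1 : ℕ) : ℝ) * (1 / (2 * d)) ≤ 1 / 2 := by
        rw [Nat.cast_sub (by omega), Nat.cast_one, mul_one_div,
          div_le_div_iff₀ (by positivity) (by norm_num)]
        nlinarith
      linarith
    have h2 : (4 * t)⁻¹ ≤ (1 - 1 / (2 * d) + 1 / (2 * t)) * (1 - 1 / (2 * (d : ℝ))) ^ (d - 1) := by
      calc (4 * t)⁻¹ = 1 / (2 * t) * (1 / 2) := by field_simp; norm_num
        _ ≤ _ := mul_le_mul (by linarith) h1 (by positivity) (by positivity)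
    calc _ ≤ ((4 * t)⁻¹)⁻¹ := inv_anti₀ (by positivity) h2
      _ = 4 * t := inv_inv _

/-! ### Extreme singular values of the adjoint operator -/

theorem measure_biUnion_finset_le_card_mul {α β : Type*} [MeasurableSpace α] (μ : Measure α)
    (N : Finset β) (A : β → Set α) {B p : ℝ} (hB : (N.card : ℝ) ≤ B) (hp : 0 ≤ p)
    (hA : ∀ x ∈ N, μ (A x) ≤ ENNReal.ofReal p) :
    μ (⋃ x ∈ N, A x) ≤ ENNReal.ofReal (B * p) := by
  calc μ (⋃ x ∈ N, A x) ≤ ∑ x ∈ N, μ (A x) := measure_biUnion_finset_le _ _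
    _ ≤ ∑ x ∈ N, ENNReal.ofReal p := Finset.sum_le_sum hA
    _ = ENNReal.ofReal (N.card * p) := by
      rw [Finset.sum_const, nsmul_eq_mul, ENNReal.ofReal_mul (by positivity), ENNReal.ofReal_natCast]
    _ ≤ _ := ENNReal.ofReal_le_ofReal (mul_le_mul_of_nonneg_right hB hp)

theorem finrank_real_euclideanSpace_complex (ι : Type*) [Fintype ι] :
    Module.finrank ℝ (EuclideanSpace ℂ ι) = 2 * Fintype.card ι := by
  rw [finrank_real_of_complex, finrank_euclideanSpace]

/-- The reduced state has no eigenvalue larger than `1600 / d`, up to exponentially small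
probability. -/
theorem uniformSphere_opNorm_tail {ι κ : Type*} [Fintype ι] [DecidableEq ι] [Fintype κ]
    [Nonempty κ] (hι : 2 ≤ Fintype.card ι) (hικ : Fintype.card ι ≤ Fintype.card κ) :
    uniformSphere (ι × κ) {ψ | 40 / √(Fintype.card ι) < ‖adjointMap ψ.1‖} ≤
      ENNReal.ofReal ((1 / 2) ^ Fintype.card κ) := by
  set d := Fintype.card ι with hdd
  have hd0 : (0 : ℝ) < d := by exact_mod_cast (by omega : 0 < d)
  obtain ⟨N, hN1, hN2, hN3⟩ := exists_net_unitSphere (EuclideanSpace ℂ ι) (ε := 1 / 2) (by norm_num)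
  rw [finrank_real_euclideanSpace_complex] at hN3
  refine (measure_mono (t := ⋃ x ∈ N, {ψ : unitSphere (ι × κ) |
    400 / (d : ℝ) ≤ ‖adjointMap ψ.1 x‖ ^ 2}) fun ψ hψ => ?_).trans
    ((measure_biUnion_finset_le_card_mul _ N _ hN3 (by positivity)
      fun x hx => uniformSphere_upper_tail hι (hN1 x hx) (by norm_num : (0 : ℝ) < 400)).trans
      (ENNReal.ofReal_le_ofReal ?_))
  · by_contra hne
    simp only [Set.mem_iUnion, Set.mem_ofPred_eq, not_exists, not_le] at hne
    have hle := opNorm_le_of_net (adjointMap ψ.1) (R := 20 / √d) (by positivity) hN2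
      fun x hx => by
        refine le_of_lt (lt_of_pow_lt_pow_left₀ 2 (by positivity) ((hne x hx).trans_eq ?_))
        rw [div_pow, Real.sq_sqrt hd0.le]
        norm_num
    have hlt : 40 / √d < ‖adjointMap ψ.1‖ := hψ
    have : 2 * (20 / √(d : ℝ)) = 40 / √d := by ring
    linarith
  · rw [← hdd]
    -- The threshold `400` makes each net point contribute `50 ^ (-s)`, which beats the net size `25
    -- ^ d` because `d ≤ s`.
    calc (1 + 2 / (1 / 2) : ℝ) ^ (2 * d) * (8 / 400) ^ Fintype.card κ
        = 25 ^ d * (8 / 400) ^ Fintype.card κ := by rw [pow_mul]; norm_num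
      _ ≤ 25 ^ Fintype.card κ * (8 / 400) ^ Fintype.card κ := by gcongr; norm_num
      _ = _ := by rw [← mul_pow]; norm_num

/-- If the environment is larger than the system by a fixed factor, the reduced state is well
conditioned up to exponentially small probability. -/
theorem uniformSphere_lower_bound_tail {ι κ : Type*} [Fintype ι] [DecidableEq ι] [Fintype κ]
    [Nonempty κ] (hι : 2 ≤ Fintype.card ι) {m : ℕ} (hικ : Fintype.card ι ≤ Fintype.card κ)
    (hm : Fintype.card κ ≤ m * (Fintype.card κ - Fintype.card ι)) {u : ℝ} (hu0 : 0 < u)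
    (hu1 : u ≤ 1) (hu : u ≤ (1 / (8 * 161 ^ 2)) ^ m) :
    uniformSphere (ι × κ) {ψ | ¬ ∀ y, ‖y‖ = 1 →
        u / (2 * √(Fintype.card ι)) ≤ ‖adjointMap ψ.1 y‖} ≤
      ENNReal.ofReal (2 * (1 / 2) ^ Fintype.card κ) := by
  set d := Fintype.card ι with hdd
  have hd0 : (0 : ℝ) < d := by exact_mod_cast (by omega : 0 < d)
  -- With operator norm at most `40 / √d`, mesh `u / 80` costs `u / (2√d)`, half of the bound `u /
  -- √d` on the net.
  obtain ⟨N, hN1, hN2, hN3⟩ := exists_net_unitSphere (EuclideanSpace ℂ ι) (ε := u / 80)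
    (by positivity)
  rw [finrank_real_euclideanSpace_complex] at hN3
  have hnet := measure_biUnion_finset_le_card_mul (uniformSphere (ι × κ)) N
    (fun x => {ψ : unitSphere (ι × κ) | ‖adjointMap ψ.1 x‖ ^ 2 ≤ u ^ 2 / (d : ℝ)}) hN3
    (by positivity) fun x hx => uniformSphere_lower_tail hι (hN1 x hx) (sq_pos_of_pos hu0)
  have hnum : (1 + 2 / (u / 80)) ^ (2 * Fintype.card ι) * (4 * u ^ 2) ^ Fintype.card κ ≤
      (1 / 2 : ℝ) ^ Fintype.card κ := by
    rw [← hdd]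
    obtain ⟨e, he⟩ : ∃ e, Fintype.card κ = d + e := ⟨Fintype.card κ - d, by omega⟩
    rw [he, Nat.add_sub_cancel_left] at hm
    have h1 : 1 + 2 / (u / 80) ≤ 161 / u := by
      rw [le_div_iff₀ hu0]
      field_simp
      linarith
    -- The net contributes `u ^ (-2d)` and the tail `u ^ (2(d + e))`, so only `u ^ (2e)` remains.
    -- Since `d + e ≤ m e`, it still absorbs the factor `(4 * 161²) ^ (d + e)` and leaves `(1/2) ^
    -- (d + e)`.
    have h2 : u ^ e ≤ (1 / (8 * 161 ^ 2)) ^ (d + e) := by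
      calc u ^ e ≤ ((1 / (8 * 161 ^ 2)) ^ m) ^ e := by gcongr
        _ = (1 / (8 * 161 ^ 2)) ^ (m * e) := (pow_mul _ _ _).symm
        _ ≤ _ := pow_le_pow_of_le_one (by norm_num) (by norm_num) hm
    have h3 : (u ^ 2) ^ e ≤ u ^ e := by
      gcongr
      nlinarith
    rw [he]
    calc (1 + 2 / (u / 80)) ^ (2 * d) * (4 * u ^ 2) ^ (d + e)
        ≤ (161 / u) ^ (2 * d) * (4 * u ^ 2) ^ (d + e) := by gcongr
      _ = (161 ^ 2) ^ d * 4 ^ (d + e) * (u ^ 2) ^ e := by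
        rw [div_pow, pow_mul, pow_mul, mul_pow, pow_add (u ^ 2)]
        field_simp
      _ ≤ (161 ^ 2) ^ (d + e) * 4 ^ (d + e) * (1 / (8 * 161 ^ 2)) ^ (d + e) := by
        gcongr
        · norm_num
        · omega
        · exact h3.trans h2
      _ = _ := by rw [← mul_pow, ← mul_pow]; norm_num
  refine (measure_mono fun ψ hψ => ?_).trans ((measure_union_le
    {ψ : unitSphere (ι × κ) | 40 / √(Fintype.card ι) < ‖adjointMap ψ.1‖} _).trans
    ((add_le_add (uniformSphere_opNorm_tail hι hικ)
      (hnet.trans (ENNReal.ofReal_le_ofReal hnum))).trans_eq ?_))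
  · by_contra hne
    rw [Set.mem_union, not_or] at hne
    obtain ⟨hop, hne⟩ := hne
    simp only [Set.mem_iUnion, Set.mem_ofPred_eq, not_exists, not_le] at hne
    rw [Set.mem_ofPred_eq, not_lt] at hop
    refine hψ fun y hy => ?_
    have hlow := le_norm_apply_of_net (adjointMap ψ.1) hN2 (r := u / √d) (fun x hx => by
      refine le_of_lt (lt_of_pow_lt_pow_left₀ 2 (norm_nonneg _) (lt_of_eq_of_lt ?_ (hne x hx)))
      rw [div_pow, Real.sq_sqrt hd0.le]) hop y hy
    refine le_trans (le_of_eq ?_) hlow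
    rw [← hdd]
    ring
  · rw [← ENNReal.ofReal_add (by positivity) (by positivity), two_mul]

/-- If the environment is larger than the system by a fixed factor, the condition number of the
reduced state is bounded up to exponentially small probability. -/
theorem exists_uniformSphere_condition_number_tail (m : ℕ) :
    ∃ K : ℝ, ∀ (ι κ : Type) [Fintype ι] [DecidableEq ι] [Fintype κ] [Nonempty κ],
      2 ≤ Fintype.card ι → Fintype.card ι ≤ Fintype.card κ →
      Fintype.card κ ≤ m * (Fintype.card κ - Fintype.card ι) →
      uniformSphere (ι × κ) {ψ | ¬ ∃ l : ℝ, 0 ≤ l ∧ ∀ y, ‖y‖ = 1 →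
        l ≤ ‖adjointMap ψ.1 y‖ ^ 2 ∧ ‖adjointMap ψ.1 y‖ ^ 2 ≤ K * l} ≤
      ENNReal.ofReal (3 * (1 / 2) ^ Fintype.card κ) := by
  set u : ℝ := (1 / (8 * 161 ^ 2)) ^ m with hu
  have hu0 : 0 < u := by positivity
  have hu1 : u ≤ 1 := pow_le_one₀ (by norm_num) (by norm_num)
  -- The ratio of the upper edge `1600 / d` to the lower edge `u² / (4d)`.
  refine ⟨6400 / u ^ 2, fun ι κ _ _ _ _ hι hικ hm => ?_⟩
  have hd0 : (0 : ℝ) < Fintype.card ι := by exact_mod_cast (by omega : 0 < Fintype.card ι)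
  refine (measure_mono fun ψ hψ => ?_).trans ((measure_union_le
    {ψ : unitSphere (ι × κ) | 40 / √(Fintype.card ι) < ‖adjointMap ψ.1‖} _).trans
    ((add_le_add (uniformSphere_opNorm_tail hι hικ)
      (uniformSphere_lower_bound_tail hι hικ hm hu0 hu1 le_rfl)).trans_eq ?_))
  · by_contra hne
    rw [Set.mem_union, not_or, Set.mem_ofPred_eq, not_lt, Set.mem_ofPred_eq, not_not] at hne
    refine hψ ⟨u ^ 2 / (4 * Fintype.card ι), by positivity, fun y hy => ⟨?_, ?_⟩⟩
    · have := pow_le_pow_left₀ (by positivity) (hne.2 y hy) 2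
      rw [div_pow, mul_pow, Real.sq_sqrt hd0.le] at this
      norm_num at this ⊢
      exact this
    · have h1 : ‖adjointMap ψ.1 y‖ ≤ 40 / √(Fintype.card ι) := by
        have := (adjointMap ψ.1).le_opNorm y
        rw [hy, mul_one] at this
        exact this.trans hne.1
      have := pow_le_pow_left₀ (norm_nonneg _) h1 2
      rw [div_pow, Real.sq_sqrt hd0.le] at this
      refine this.trans (le_of_eq ?_)
      field_simp
      norm_num
  · rw [← ENNReal.ofReal_add (by positivity) (by positivity)]
    congr 1
    ring

/-! ### Induced states and a sufficient spectral condition -/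

theorem inducedState_eq {ι : Type*} [Fintype ι] {s : ℕ} (ψ : unitSphere (ι × Fin s)) :
    inducedState ψ = vecMatrix ψ.1.ofLp * (vecMatrix ψ.1.ofLp)ᴴ := by
  ext i j
  rfl

theorem trace_inducedState {ι : Type*} [Fintype ι] {s : ℕ} (ψ : unitSphere (ι × Fin s)) :
    (inducedState ψ).trace = 1 := by
  have h : ∑ p, ‖ψ.1 p‖ ^ 2 = 1 := by
    rw [← EuclideanSpace.norm_sq_eq, mem_sphere_zero_iff_norm.1 ψ.2, one_pow]
  have h2 : (inducedState ψ).trace = ∑ i, ∑ j, ψ.1 (i, j) * star (ψ.1 (i, j)) := rfl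
  refine Eq.trans ?_ (congrArg Complex.ofReal h)
  rw [h2, ← Fintype.sum_prod_type', Complex.ofReal_sum]
  exact Finset.sum_congr rfl fun p _ => by
    rw [Complex.star_def, Complex.mul_conj, Complex.normSq_eq_norm_sq]

theorem inducedState_mem_densityMatrices {ι : Type*} [Fintype ι] {s : ℕ}
    (ψ : unitSphere (ι × Fin s)) : inducedState ψ ∈ densityMatrices ι := by
  refine ⟨?_, trace_inducedState ψ⟩
  rw [inducedState_eq]
  exact Matrix.posSemidef_self_mul_conjTranspose _

theorem rank_inducedState_le {ι : Type*} [Fintype ι] {s : ℕ} (ψ : unitSphere (ι × Fin s)) :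
    (inducedState ψ).rank ≤ s := by
  rw [inducedState_eq]
  refine (Matrix.rank_mul_le_left _ _).trans ?_
  simpa using Matrix.rank_le_card_width (vecMatrix ψ.1.ofLp)

theorem star_dotProduct_inducedState_mulVec {ι : Type*} [Fintype ι] [DecidableEq ι] {s : ℕ}
    (ψ : unitSphere (ι × Fin s)) (x : ι → ℂ) :
    star x ⬝ᵥ inducedState ψ *ᵥ x = ((‖adjointMap ψ.1 (WithLp.toLp 2 x)‖ ^ 2 : ℝ) : ℂ) := by
  rw [inducedState_eq, ← Matrix.mulVec_mulVec, Matrix.dotProduct_mulVec,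
    ← Matrix.conjTranspose_conjTranspose (vecMatrix ψ.1.ofLp), ← Matrix.star_mulVec,
    Matrix.conjTranspose_conjTranspose, EuclideanSpace.norm_sq_eq, ofLp_adjointMap,
    Complex.ofReal_sum, dotProduct]
  exact Finset.sum_congr rfl fun j _ => by
    rw [Pi.star_apply, Complex.star_def, mul_comm, Complex.mul_conj, Complex.normSq_eq_norm_sq]

theorem norm_sq_apply_bounds {E F : Type*} [NormedAddCommGroup E] [NormedSpace ℂ E]
    [NormedAddCommGroup F] [NormedSpace ℂ F] (T : E →L[ℂ] F) {l L : ℝ}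
    (h : ∀ y, ‖y‖ = 1 → l ≤ ‖T y‖ ^ 2 ∧ ‖T y‖ ^ 2 ≤ L) (x : E) :
    l * ‖x‖ ^ 2 ≤ ‖T x‖ ^ 2 ∧ ‖T x‖ ^ 2 ≤ L * ‖x‖ ^ 2 := by
  rcases eq_or_ne x 0 with rfl | hx
  · simp
  have hx' : 0 < ‖x‖ := norm_pos_iff.2 hx
  have h1 := h (((‖x‖⁻¹ : ℝ) : ℂ) • x) (by
    rw [norm_smul, Complex.norm_real, norm_inv, norm_norm, inv_mul_cancel₀ hx'.ne'])
  rw [map_smul, norm_smul, Complex.norm_real, norm_inv, norm_norm, mul_pow, inv_pow,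
    inv_mul_eq_div, le_div_iff₀ (by positivity), div_le_iff₀ (by positivity)] at h1
  exact h1

theorem Matrix.PosSemidef.sub_smul_one_of_le {ι : Type*} [Fintype ι] [DecidableEq ι]
    {A : Matrix ι ι ℂ} (hA : A.IsHermitian) {l : ℝ}
    (h : ∀ x : ι → ℂ, ((l * ‖WithLp.toLp 2 x‖ ^ 2 : ℝ) : ℂ) ≤ star x ⬝ᵥ A *ᵥ x) :
    (A - (l : ℂ) • (1 : Matrix ι ι ℂ)).PosSemidef := by
  refine Matrix.PosSemidef.of_dotProduct_mulVec_nonneg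
    (hA.sub (by simp [Matrix.IsHermitian, Matrix.conjTranspose_smul])) fun x => ?_
  rw [Matrix.sub_mulVec, dotProduct_sub, sub_nonneg, Matrix.smul_mulVec, Matrix.one_mulVec,
    dotProduct_smul]
  refine le_trans (le_of_eq ?_) (h x)
  rw [Complex.ofReal_mul, smul_eq_mul, EuclideanSpace.norm_sq_eq, Complex.ofReal_sum, dotProduct]
  congr 1
  exact Finset.sum_congr rfl fun j _ => by
    rw [Pi.star_apply, Complex.star_def, mul_comm, Complex.mul_conj, Complex.normSq_eq_norm_sq]

theorem Matrix.PosSemidef.partialTrace {α β : Type*} [Fintype α] [Fintype β]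
    {X : Matrix (α × β) (α × β) ℂ} (hX : X.PosSemidef) : (partialTrace X).PosSemidef := by
  have h : _root_.partialTrace X = ∑ b, X.submatrix (fun a => (a, b)) fun a => (a, b) := by
    ext a a'
    simp [_root_.partialTrace, Matrix.sum_apply]
  rw [h]
  exact Matrix.posSemidef_sum _ fun b _ => hX.submatrix _

/-- A matrix between `l` and `L` with `L ≤ k l` satisfies the reduction criterion. -/
theorem posSemidef_reduction_of_bounds {α β : Type*} [Fintype α] [DecidableEq α] [Fintype β]
    [DecidableEq β] {X : Matrix (α × β) (α × β) ℂ} {l L : ℝ}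
    (hl : (X - (l : ℂ) • (1 : Matrix (α × β) (α × β) ℂ)).PosSemidef)
    (hL : ((L : ℂ) • (1 : Matrix (α × β) (α × β) ℂ) - X).PosSemidef)
    (hlL : L ≤ Fintype.card β * l) : (reduction X).PosSemidef := by
  -- Since `(X - l)_A = X_A - k l`, the reduction splits as `(X - l)_A ⊗ 1 + (L - X) + (k l - L)`, a
  -- sum of positive terms.
  have h : reduction X =
      (partialTrace (X - (l : ℂ) • (1 : Matrix (α × β) (α × β) ℂ)) ⊗ₖ (1 : Matrix β β ℂ) +
        ((L : ℂ) • (1 : Matrix (α × β) (α × β) ℂ) - X)) +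
        ((Fintype.card β * l - L : ℝ) : ℂ) • (1 : Matrix (α × β) (α × β) ℂ) := by
    ext ⟨a, b⟩ ⟨a', b'⟩
    by_cases ha : a = a' <;> by_cases hb : b = b' <;>
      simp [reduction, partialTrace, Matrix.one_apply, Matrix.kroneckerMap_apply, ha, hb] <;>
      ring
  rw [h]
  refine ((hl.partialTrace.kronecker Matrix.PosSemidef.one).add hL).add
    (Matrix.PosSemidef.one.smul ?_)
  exact_mod_cast sub_nonneg.2 hlL

theorem mul_sub_smul_one_mul_conjTranspose {ι : Type*} [Fintype ι] [DecidableEq ι]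
    {U : Matrix ι ι ℂ} (hU : U ∈ Matrix.unitaryGroup ι ℂ) (A : Matrix ι ι ℂ) (z : ℂ) :
    U * (A - z • (1 : Matrix ι ι ℂ)) * Uᴴ = U * A * Uᴴ - z • (1 : Matrix ι ι ℂ) := by
  have h : U * Uᴴ = 1 := Matrix.mem_unitaryGroup_iff.1 hU
  rw [mul_sub, sub_mul, Matrix.mul_smul, mul_one, Matrix.smul_mul, h]

/-- The bounds `l ≤ ρ ≤ L` survive conjugation by a unitary, so a single spectral condition handles
every `U`. -/
theorem inducedState_mem_ARED {n k s : ℕ} (ψ : unitSphere ((Fin n × Fin k) × Fin s)) {l L : ℝ}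
    (h : ∀ y, ‖y‖ = 1 → l ≤ ‖adjointMap ψ.1 y‖ ^ 2 ∧ ‖adjointMap ψ.1 y‖ ^ 2 ≤ L)
    (hlL : L ≤ k * l) : inducedState ψ ∈ ARED n k := by
  have hd := inducedState_mem_densityMatrices ψ
  refine ⟨hd, fun U hU => ?_⟩
  have hb := norm_sq_apply_bounds _ h
  have h1 := Matrix.PosSemidef.sub_smul_one_of_le hd.1.isHermitian (l := l) fun x => by
    rw [star_dotProduct_inducedState_mulVec, Complex.real_le_real]
    exact (hb _).1
  -- The upper bound on the state is the lower bound `-L` on its negative.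
  have h2 := Matrix.PosSemidef.sub_smul_one_of_le hd.1.isHermitian.neg (l := -L) fun x => by
    rw [Matrix.neg_mulVec, dotProduct_neg, star_dotProduct_inducedState_mulVec,
      ← Complex.ofReal_neg, Complex.real_le_real, neg_mul, neg_le_neg_iff]
    exact (hb _).2
  have h1' := h1.mul_mul_conjTranspose_same U
  have h2' := h2.mul_mul_conjTranspose_same U
  rw [mul_sub_smul_one_mul_conjTranspose hU] at h1' h2'
  refine posSemidef_reduction_of_bounds h1' (L := L) ?_ (by simpa using hlL)
  have h3 : (L : ℂ) • (1 : Matrix (Fin n × Fin k) (Fin n × Fin k) ℂ) - U * inducedState ψ * Uᴴ =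
      U * -inducedState ψ * Uᴴ - ((-L : ℝ) : ℂ) • (1 : Matrix _ _ ℂ) := by
    rw [mul_neg, neg_mul, Complex.ofReal_neg, neg_smul]
    abel
  rw [h3]
  exact h2'

/-! ### Measurability -/

instance instBorelSpaceComplexMatrix {m n : Type*} [Countable m] [Countable n] :
    BorelSpace (Matrix m n ℂ) :=
  inferInstanceAs (BorelSpace (m → n → ℂ))

theorem isClosed_setOf_posSemidef (ι : Type*) [Fintype ι] :
    IsClosed {A : Matrix ι ι ℂ | A.PosSemidef} := by
  simp only [Matrix.posSemidef_iff_dotProduct_mulVec, Set.ofPred_and, Set.ofPred_forall]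
  refine IsClosed.inter (isClosed_eq (by fun_prop) continuous_id) (isClosed_iInter fun x =>
    isClosed_le continuous_const ?_)
  fun_prop

theorem continuous_reduction {α β : Type*} [Fintype β] [DecidableEq β] :
    Continuous (reduction : Matrix (α × β) (α × β) ℂ → _) := by
  refine continuous_matrix fun p q => ?_
  change Continuous fun X : Matrix (α × β) (α × β) ℂ =>
    (∑ b, X (p.1, b) (q.1, b)) * (1 : Matrix β β ℂ) p.2 q.2 - X p q
  fun_prop

/-- Closedness yields measurability despite the intersection over uncountably many unitaries. -/
theorem isClosed_ARED (n k : ℕ) : IsClosed (ARED n k) := by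
  simp only [ARED, densityMatrices, Set.ofPred_and, Set.ofPred_forall]
  refine ((isClosed_setOf_posSemidef _).inter (isClosed_eq (by fun_prop) continuous_const)).inter
    (isClosed_iInter fun U => isClosed_iInter fun _ =>
      (isClosed_setOf_posSemidef _).preimage (continuous_reduction.comp ?_))
  fun_prop

theorem continuous_inducedState {ι : Type*} [Fintype ι] {s : ℕ} :
    Continuous (inducedState : unitSphere (ι × Fin s) → Matrix ι ι ℂ) := by
  refine continuous_matrix fun i j => ?_
  change Continuous fun ψ : unitSphere (ι × Fin s) => ∑ b, ψ.1 (i, b) * star (ψ.1 (j, b))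
  fun_prop

/-! ### Violation of the criterion by states of small rank -/

/-- A permutation can place a given element outside `Z` at a given position of `T` and elements of
`Z` at all the other positions of `T`, when `Z` is large enough. -/
theorem exists_perm_mapsTo {γ : Type*} [Fintype γ] [DecidableEq γ] (T Z : Finset γ)
    (hTZ : T.card ≤ Z.card) {p₀ q₀ : γ} (hp : p₀ ∈ T) (hq : q₀ ∉ Z) :
    ∃ σ : Equiv.Perm γ, σ p₀ = q₀ ∧ ∀ p ∈ T, p ≠ p₀ → σ p ∈ Z := by
  obtain ⟨Z', hZ', hcard⟩ := Finset.exists_subset_card_eq hTZ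
  let e : T ≃ Z' := Finset.equivOfCardEq hcard.symm
  -- Values outside `T` are irrelevant: only injectivity on `T` is used to extend `f` to a
  -- permutation.
  let f : γ → γ := fun p => if p = p₀ then q₀ else if h : p ∈ T then e ⟨p, h⟩ else q₀
  have hf : ∀ (p) (h : p ∈ T), p ≠ p₀ → f p = e ⟨p, h⟩ := fun p h hne => by simp [f, hne, h]
  have hf0 : f p₀ = q₀ := by simp [f]
  have hfZ : ∀ p ∈ T, p ≠ p₀ → f p ∈ Z := fun p h hne => by
    rw [hf p h hne]
    exact hZ' (e ⟨p, h⟩).2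
  have hinj : Set.InjOn f T := by
    intro p hpT q hqT hpq
    by_cases h1 : p = p₀ <;> by_cases h2 : q = p₀
    · rw [h1, h2]
    · rw [h1, hf0] at hpq
      exact absurd (hpq ▸ hfZ q hqT h2) hq
    · rw [h2, hf0] at hpq
      exact absurd (hpq ▸ hfZ p hpT h1) hq
    · rw [hf p hpT h1, hf q hqT h2] at hpq
      simpa using e.injective (Subtype.ext hpq)
  obtain ⟨g, hg⟩ := Set.MapsTo.exists_equiv_extend_of_card_eq (t := Finset.univ)
    (Finset.card_univ (α := γ)).symm (fun p _ => by simp) hinj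
  let σ : Equiv.Perm γ := g.trans (Equiv.subtypeUnivEquiv fun x => Finset.mem_univ x)
  have hσ : ∀ p ∈ T, σ p = f p := fun p h => hg p h
  exact ⟨σ, (hσ p₀ hp).trans hf0, fun p h hne => by rw [hσ p h]; exact hfZ p h hne⟩

/-- A Hermitian matrix can be rotated to have the same eigenvalues and any given orthonormal
eigenbasis. -/
theorem exists_unitary_conj_apply {ι : Type*} [Fintype ι] [DecidableEq ι] {A : Matrix ι ι ℂ}
    (hA : A.IsHermitian) (f : OrthonormalBasis ι ℂ (EuclideanSpace ℂ ι)) (σ : Equiv.Perm ι) :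
    ∃ U ∈ Matrix.unitaryGroup ι ℂ, ∀ q q', (U * A * Uᴴ) q q' =
      ∑ p, (hA.eigenvalues (σ p) : ℂ) * (f p q * star (f p q')) := by
  let V : Matrix ι ι ℂ := hA.eigenvectorUnitary
  have hVm : V ∈ Matrix.unitaryGroup ι ℂ := hA.eigenvectorUnitary.2
  let D : Matrix ι ι ℂ := Matrix.diagonal fun i => (hA.eigenvalues i : ℂ)
  have hspec : A = V * D * Vᴴ := hA.spectral_theorem
  have hVV : Vᴴ * V = 1 := Matrix.mem_unitaryGroup_iff'.1 hVm
  -- Column `σ p` of `W` is `f p`, which pairs `f p` with the eigenvalue of index `σ p`.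
  let W : Matrix ι ι ℂ := Matrix.of fun q p => f (σ.symm p) q
  have hW : W ∈ Matrix.unitaryGroup ι ℂ := by
    rw [Matrix.mem_unitaryGroup_iff', Matrix.star_eq_conjTranspose]
    ext p p'
    have h1 := orthonormal_iff_ite.1 f.orthonormal (σ.symm p) (σ.symm p')
    rw [EuclideanSpace.inner_eq_star_dotProduct, dotProduct] at h1
    rw [Matrix.mul_apply, Matrix.one_apply]
    simp only [EmbeddingLike.apply_eq_iff_eq] at h1
    rw [← h1]
    exact Finset.sum_congr rfl fun q _ => mul_comm _ _
  have hVs : Vᴴ ∈ Matrix.unitaryGroup ι ℂ := Unitary.star_mem hVm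
  refine ⟨W * Vᴴ, mul_mem hW hVs, fun q q' => ?_⟩
  have h2 : W * Vᴴ * A * (W * Vᴴ)ᴴ = W * D * Wᴴ := by
    rw [Matrix.conjTranspose_mul, Matrix.conjTranspose_conjTranspose]
    nth_rewrite 1 [hspec]
    calc W * Vᴴ * (V * D * Vᴴ) * (V * Wᴴ) = W * (Vᴴ * V) * D * (Vᴴ * V) * Wᴴ := by
          simp only [Matrix.mul_assoc]
      _ = _ := by rw [hVV, mul_one, mul_one]
  rw [h2, Matrix.mul_apply, ← Equiv.sum_comp σ]
  refine Finset.sum_congr rfl fun p _ => ?_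
  rw [Matrix.mul_diagonal, Matrix.conjTranspose_apply]
  simp only [W, Matrix.of_apply, Equiv.symm_apply_apply]
  ring

/-- An orthonormal basis containing `(e₀₀ + e₁₁) / √2` and all product vectors `e_{ab}` with
`a ≠ 0, 1`. -/
theorem exists_orthonormalBasis_bell {α β : Type*} [Fintype α] [DecidableEq α] [Fintype β]
    [DecidableEq β] {a₀ a₁ : α} (ha : a₀ ≠ a₁) (b₀ b₁ : β) :
    ∃ f : OrthonormalBasis (α × β) ℂ (EuclideanSpace ℂ (α × β)),
      (∀ q, f (a₀, b₀) q = if q = (a₀, b₀) ∨ q = (a₁, b₁) then ((√2)⁻¹ : ℂ) else 0) ∧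
      ∀ p : α × β, p.1 ≠ a₀ → p.1 ≠ a₁ → ∀ q, f p q = if q = p then 1 else 0 := by
  let φ : EuclideanSpace ℂ (α × β) := WithLp.toLp 2 fun q =>
    if q = (a₀, b₀) ∨ q = (a₁, b₁) then ((√2)⁻¹ : ℂ) else 0
  let v : α × β → EuclideanSpace ℂ (α × β) := fun p =>
    if p = (a₀, b₀) then φ else EuclideanSpace.single p 1
  have hne : ((a₀, b₀) : α × β) ≠ (a₁, b₁) := fun h => ha (congrArg Prod.fst h)
  have hφ : ∀ q, φ q = if q = (a₀, b₀) ∨ q = (a₁, b₁) then ((√2)⁻¹ : ℂ) else 0 := fun q => rfl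
  have hnorm : ‖φ‖ = 1 := by
    have h1 : ‖φ‖ ^ 2 = 1 := by
      rw [EuclideanSpace.norm_sq_eq]
      have h2 : ∀ q, ‖φ q‖ ^ 2 =
          (if q = (a₀, b₀) then 1 / 2 else 0) + if q = (a₁, b₁) then 1 / 2 else (0 : ℝ) := by
        intro q
        rw [hφ]
        by_cases h3 : q = (a₀, b₀)
        · simp [h3, hne]
        · by_cases h4 : q = (a₁, b₁)
          · simp [h4, hne.symm]
          · simp [h3, h4]
      simp only [h2]
      rw [Finset.sum_add_distrib]
      simp
      norm_num
    have h5 := norm_nonneg φ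
    nlinarith
  -- The rest of rows `a₀, a₁` is left out: `e_{a₁b₁}` is not orthogonal to `φ`, and any completion
  -- there will do.
  let S : Set (α × β) := {p | p = (a₀, b₀) ∨ (p.1 ≠ a₀ ∧ p.1 ≠ a₁)}
  have horth : Orthonormal ℂ (S.domRestrict v) := by
    refine ⟨fun ⟨p, hp⟩ => ?_, fun ⟨p, hp⟩ ⟨q, hq⟩ hpq => ?_⟩
    · by_cases h : p = (a₀, b₀) <;> simp [v, h, hnorm]
    · have hpq' : p ≠ q := fun h => hpq (Subtype.ext h)
      have key : ∀ r : α × β, r.1 ≠ a₀ → r.1 ≠ a₁ → φ r = 0 := by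
        intro r h0 h1
        rw [hφ, if_neg]
        rintro (rfl | rfl)
        · exact h0 rfl
        · exact h1 rfl
      simp only [Set.domRestrict_apply, v]
      split_ifs with h1 h2 h2
      · exact absurd (h1.trans h2.symm) hpq'
      · obtain ⟨h3, h4⟩ := hq.resolve_left h2
        rw [EuclideanSpace.inner_single_right, key q h3 h4]
        simp
      · obtain ⟨h3, h4⟩ := hp.resolve_left h1
        rw [EuclideanSpace.inner_single_left, key p h3 h4]
        simp
      · rw [EuclideanSpace.inner_single_left]
        simp [hpq']
  obtain ⟨f, hf⟩ := horth.exists_orthonormalBasis_extension_of_card_eq (by simp)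
  refine ⟨f, fun q => ?_, fun p h0 h1 q => ?_⟩
  · rw [hf _ (Or.inl rfl)]
    simp only [v, if_pos]
    exact hφ q
  · have h2 : p ≠ (a₀, b₀) := fun h => h0 (congrArg Prod.fst h)
    rw [hf p (Or.inr ⟨h0, h1⟩)]
    simp only [v, if_neg h2]
    simp

/-- A state of small rank violates the reduction criterion after some global rotation. -/
theorem exists_not_posSemidef_reduction_of_rank_le {α β : Type*} [Fintype α] [DecidableEq α]
    [Fintype β] [DecidableEq β] [Nontrivial α] [Nontrivial β]
    {A : Matrix (α × β) (α × β) ℂ} (hA : A ∈ densityMatrices (α × β))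
    (hrank : A.rank + 2 * Fintype.card β ≤ Fintype.card (α × β)) :
    ∃ U ∈ Matrix.unitaryGroup (α × β) ℂ, ¬ (reduction (U * A * Uᴴ)).PosSemidef := by
  obtain ⟨a₀, a₁, ha⟩ := exists_pair_ne α
  obtain ⟨b₀, b₁, hb⟩ := exists_pair_ne β
  obtain ⟨hpsd, htr⟩ := hA
  have hH := hpsd.isHermitian
  obtain ⟨i₁, hi₁⟩ : ∃ i, hH.eigenvalues i ≠ 0 := by
    by_contra! h
    rw [hH.trace_eq_sum_eigenvalues] at htr
    simp [h] at htr
  let Z : Finset (α × β) := Finset.univ.filter fun i => hH.eigenvalues i = 0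
  let T : Finset (α × β) := {a₀, a₁} ×ˢ Finset.univ
  have hT : T.card = 2 * Fintype.card β := by
    rw [Finset.card_product, Finset.card_pair ha, Finset.card_univ]
  have hZ : T.card ≤ Z.card := by
    have h1 := Finset.card_filter_add_card_filter_not (s := (Finset.univ : Finset (α × β)))
      (fun i => hH.eigenvalues i = 0)
    have h2 := hH.rank_eq_card_non_zero_eigs
    simp only [Fintype.card_subtype, ne_eq] at h2
    rw [Finset.card_univ] at h1
    change T.card ≤ (Finset.univ.filter fun i => hH.eigenvalues i = 0).card
    omega
  obtain ⟨σ, hσ0, hσ⟩ := exists_perm_mapsTo T Z hZ (p₀ := (a₀, b₀)) (q₀ := i₁) (by simp [T])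
    (by simpa [Z] using hi₁)
  obtain ⟨f, hf0, hf⟩ := exists_orthonormalBasis_bell ha b₀ b₁
  obtain ⟨U, hU, hX⟩ := exists_unitary_conj_apply hH f σ
  refine ⟨U, hU, fun hred => ?_⟩
  set X := U * A * Uᴴ with hXdef
  have hne : ((a₀, b₀) : α × β) ≠ (a₁, b₁) := fun h => ha (congrArg Prod.fst h)
  -- Basis vectors indexed by `T` other than the entangled one carry eigenvalue `0`, and those
  -- indexed outside `T` vanish on `T`.
  have hent : ∀ q ∈ T, ∀ q' ∈ T, X q q' =
      if (q = (a₀, b₀) ∨ q = (a₁, b₁)) ∧ (q' = (a₀, b₀) ∨ q' = (a₁, b₁)) then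
        (hH.eigenvalues i₁ : ℂ) / 2 else 0 := by
    intro q hq q' hq'
    rw [hX, Finset.sum_eq_single (a₀, b₀), hσ0, hf0, hf0]
    · have h2 : ((√2 : ℝ) : ℂ)⁻¹ * ((√2 : ℝ) : ℂ)⁻¹ = 1 / 2 := by
        rw [← mul_inv, ← Complex.ofReal_mul, Real.mul_self_sqrt (by norm_num)]
        norm_num
      by_cases h3 : q = (a₀, b₀) ∨ q = (a₁, b₁) <;> by_cases h4 : q' = (a₀, b₀) ∨ q' = (a₁, b₁)
      · simp only [h3, h4, if_true, and_self]
        simp [h2]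
        ring
      · simp [h3, h4]
      · simp [h3, h4]
      · simp [h3, h4]
    · intro p _ hp
      by_cases hpT : p ∈ T
      · have : hH.eigenvalues (σ p) = 0 := by simpa [Z] using hσ p hpT hp
        simp [this]
      · have h3 : p.1 ≠ a₀ ∧ p.1 ≠ a₁ := by simpa [T] using hpT
        have h4 : q ≠ p := fun h => hpT (h ▸ hq)
        rw [hf p h3.1 h3.2 q, if_neg h4]
        simp
    · simp
  have hT0 : ∀ b, (a₀, b) ∈ T := fun b => by simp [T]
  have hT1 : ∀ b, (a₁, b) ∈ T := fun b => by simp [T]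
  -- In this `2 × 2` minor the diagonal of `X_A ⊗ 1` cancels that of `X`, while `b₀ ≠ b₁` removes
  -- `X_A ⊗ 1` off the diagonal. The determinant is `-(λ/2)² < 0`.
  have hdet := (hred.submatrix ![((a₀, b₀) : α × β), (a₁, b₁)]).det_nonneg
  have hr : ∀ p q, reduction X p q =
      (∑ b, X (p.1, b) (q.1, b)) * (1 : Matrix β β ℂ) p.2 q.2 - X p q := fun p q => rfl
  have e00 : reduction X (a₀, b₀) (a₀, b₀) = 0 := by
    rw [hr]
    simp [hent _ (hT0 _) _ (hT0 _), ha]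
  have e11 : reduction X (a₁, b₁) (a₁, b₁) = 0 := by
    rw [hr]
    simp [hent _ (hT1 _) _ (hT1 _), ha.symm]
  have e01 : reduction X (a₀, b₀) (a₁, b₁) = -((hH.eigenvalues i₁ : ℂ) / 2) := by
    rw [hr, hent _ (hT0 _) _ (hT1 _)]
    simp [hb]
  have e10 : reduction X (a₁, b₁) (a₀, b₀) = -((hH.eigenvalues i₁ : ℂ) / 2) := by
    rw [hr, hent _ (hT1 _) _ (hT0 _)]
    simp [hb.symm]
  rw [Matrix.det_fin_two] at hdet
  simp only [Matrix.submatrix_apply, Matrix.cons_val_zero, Matrix.cons_val_one, e00, e01, e10,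
    e11] at hdet
  have h6 : (0 : ℂ) ≤ ((-(hH.eigenvalues i₁ / 2) ^ 2 : ℝ) : ℂ) := by
    refine hdet.trans_eq ?_
    push_cast
    ring
  rw [Complex.zero_le_real] at h6
  have h7 : 0 < (hH.eigenvalues i₁ / 2) ^ 2 := by positivity
  linarith

/-! ### Borel–Cantelli and the threshold -/

/-- Borel–Cantelli for a shifted sequence, since the laws are prescribed only for large `n`. -/
theorem ae_eventually_notMem_of_eventually_le {Ω : Type*} [MeasurableSpace Ω] {P : Measure Ω}
    {A : ℕ → Set Ω} {b : ℕ → ENNReal} (hb : ∑' n, b n ≠ ⊤) (h : ∀ᶠ n in atTop, P (A n) ≤ b n) :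
    ∀ᵐ ω ∂P, ∀ᶠ n in atTop, ω ∉ A n := by
  obtain ⟨N, hN⟩ := eventually_atTop.1 h
  have hsum : ∑' n, P (A (n + N)) ≠ ⊤ :=
    ne_top_of_le_ne_top hb ((ENNReal.tsum_le_tsum fun n => hN (n + N) (by omega)).trans
      (ENNReal.tsum_comp_le_tsum_of_injective (add_left_injective N) b))
  filter_upwards [ae_eventually_notMem hsum] with ω hω
  obtain ⟨M, hM⟩ := eventually_atTop.1 hω
  refine eventually_atTop.2 ⟨M + N, fun n hn => ?_⟩
  have := hM (n - N) (by omega)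
  rwa [Nat.sub_add_cancel (by omega)] at this

theorem measure_eq_uniformSphere_of_hasLaw {Ω : Type*} [MeasurableSpace Ω] {P : Measure Ω}
    {ι : Type*} [Fintype ι] {s : ℕ} {X : Ω → Matrix ι ι ℂ} (hX : HasLaw X (inducedMeasure ι s) P)
    {S : Set (Matrix ι ι ℂ)} (hS : MeasurableSet S) :
    P {ω | X ω ∈ S} = uniformSphere (ι × Fin s) {ψ | inducedState ψ ∈ S} := by
  have h := hX.measure_eq (p := fun A => A ∈ S) hS
  rw [h, inducedMeasure]
  exact Measure.map_apply continuous_inducedState.measurable hS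

theorem inducedState_notMem_ARED {n k s : ℕ} (hn : 2 ≤ n) (hk : 2 ≤ k) (h : s + 2 * k ≤ n * k)
    (ψ : unitSphere ((Fin n × Fin k) × Fin s)) : inducedState ψ ∉ ARED n k := by
  rintro ⟨hd, hU⟩
  have : Nontrivial (Fin n) := Fin.nontrivial_iff_two_le.2 hn
  have : Nontrivial (Fin k) := Fin.nontrivial_iff_two_le.2 hk
  obtain ⟨U, hUm, hneg⟩ := exists_not_posSemidef_reduction_of_rank_le hd (by
    have := rank_inducedState_le ψ
    simp only [Fintype.card_prod, Fintype.card_fin]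
    omega)
  exact hneg (hU U hUm)

theorem theorem5p5 {Ω : Type*} [MeasurableSpace Ω] (P : Measure Ω) [IsProbabilityMeasure P]
    (k s : ℕ → ℕ) (c : ℝ) (hc : 0 < c)
    (hk : Tendsto k atTop atTop)
    (hs : Asymptotics.IsEquivalent atTop (fun n : ℕ => (s n : ℝ))
      (fun n : ℕ => c * ((n : ℝ) * (k n : ℝ))))
    (ρ : (n : ℕ) → Ω → Matrix (Fin n × Fin (k n)) (Fin n × Fin (k n)) ℂ)
    (hρ : ∀ᶠ n in atTop, HasLaw (ρ n) (inducedMeasure (Fin n × Fin (k n)) (s n)) P) :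
    (1 < c → ∀ᵐ ω ∂P, ∀ᶠ n in atTop, ρ n ω ∈ ARED n (k n)) ∧
    (c < 1 → ∀ᵐ ω ∂P, ∀ᶠ n in atTop, ρ n ω ∉ ARED n (k n)) := by
  have hclose : ∀ ε : ℝ, 0 < ε → ∀ᶠ n in atTop,
      |(s n : ℝ) - c * ((n : ℝ) * k n)| ≤ ε * ((n : ℝ) * k n) := by
    intro ε hε
    filter_upwards [hs.isLittleO.def (div_pos hε hc)] with n hn
    rw [Pi.sub_apply, Real.norm_eq_abs, Real.norm_of_nonneg (by positivity)] at hn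
    refine hn.trans_eq ?_
    field_simp
  constructor
  · intro hc1
    -- Eventually `s ≥ (c + 1) / 2 * d`, hence `s - d ≥ (c - 1) / (c + 1) * s`.
    obtain ⟨m, hm⟩ := exists_nat_ge ((c + 1) / (c - 1))
    rw [div_le_iff₀ (by linarith)] at hm
    obtain ⟨K, hK⟩ := exists_uniformSphere_condition_number_tail m
    have hm1 : (1 : ℝ) ≤ m := by
      have : m ≠ 0 := by
        rintro rfl
        norm_num at hm
        linarith
      exact_mod_cast Nat.one_le_iff_ne_zero.2 this
    have hsum : ∑' n : ℕ, ENNReal.ofReal (3 * (1 / 2) ^ n) ≠ ⊤ :=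
      ((summable_geometric_of_lt_one (by norm_num) (by norm_num)).mul_left 3).tsum_ofReal_ne_top
    have hbad := ae_eventually_notMem_of_eventually_le (P := P)
      (A := fun n => {ω | ρ n ω ∈ (ARED n (k n))ᶜ}) hsum (by
        filter_upwards [hρ, hclose ((c - 1) / 2) (by linarith), eventually_ge_atTop 2,
          hk.eventually_ge_atTop 1,
          (tendsto_natCast_atTop_atTop.comp hk).eventually_ge_atTop K] with n hlaw hn hn2 hk1 hKk
        have hd : (0 : ℝ) ≤ (n : ℝ) * k n := by positivity
        have hlow : (c + 1) / 2 * ((n : ℝ) * k n) ≤ s n := by linarith [(abs_le.1 hn).1]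
        have hds : n * k n ≤ s n := by
          have : (n : ℝ) * k n ≤ s n := by nlinarith
          exact_mod_cast this
        have hnd : n ≤ n * k n := Nat.le_mul_of_pos_right n hk1
        have hms : s n ≤ m * (s n - n * k n) := by
          have : (s n : ℝ) ≤ m * (s n - n * k n) := by nlinarith
          rw [← Nat.cast_mul, ← Nat.cast_sub hds] at this
          exact_mod_cast this
        have : Nonempty (Fin (s n)) := ⟨⟨0, by omega⟩⟩
        rw [measure_eq_uniformSphere_of_hasLaw hlaw (isClosed_ARED n (k n)).measurableSet.compl]
        refine (measure_mono fun ψ hψ => ?_).trans ((hK (Fin n × Fin (k n)) (Fin (s n))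
          (by simp; omega) (by simpa using hds) (by simpa using hms)).trans
          (ENNReal.ofReal_le_ofReal ?_))
        · rintro ⟨l, hl, hb⟩
          -- Growth of `k n` enters here: it eventually exceeds the fixed condition number bound
          -- `K`.
          exact hψ (inducedState_mem_ARED ψ hb (mul_le_mul_of_nonneg_right hKk hl))
        · rw [Fintype.card_fin]
          exact mul_le_mul_of_nonneg_left
            (pow_le_pow_of_le_one (by norm_num) (by norm_num) (hnd.trans hds)) (by norm_num))
    filter_upwards [hbad] with ω hω
    filter_upwards [hω] with n hn
    exact not_not.1 hn
  · intro hc1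
    -- For large `n` the event is null, since no unit vector induces a state in `ARED`. The
    -- requirement `4 ≤ n (1 - c)` fits `2k` into the gap `(1 - c) / 2 * n k`.
    refine ae_eventually_notMem_of_eventually_le (A := fun n => {ω | ρ n ω ∈ ARED n (k n)})
      (b := fun _ => 0) (by simp) ?_
    filter_upwards [hρ, hclose ((1 - c) / 2) (by linarith), eventually_ge_atTop 2,
      tendsto_natCast_atTop_atTop.eventually_ge_atTop (4 / (1 - c)),
      hk.eventually_ge_atTop 2] with n hlaw hn hn2 hn4 hk2
    rw [div_le_iff₀ (by linarith)] at hn4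
    have hle : s n + 2 * k n ≤ n * k n := by
      have h1 := (abs_le.1 hn).2
      have h2 := mul_le_mul_of_nonneg_right hn4 (Nat.cast_nonneg (α := ℝ) (k n))
      have : (s n : ℝ) + 2 * k n ≤ n * k n := by linarith
      exact_mod_cast this
    rw [measure_eq_uniformSphere_of_hasLaw hlaw (isClosed_ARED n (k n)).measurableSet]
    have hempty : {ψ : unitSphere ((Fin n × Fin (k n)) × Fin (s n)) |
        inducedState ψ ∈ ARED n (k n)} = ∅ :=
      Set.eq_empty_of_forall_notMem fun ψ hψ => inducedState_notMem_ARED hn2 hk2 hle ψ hψ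
    rw [hempty, measure_empty]
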